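/- All groups are finite. A formation is an isomorphism-closed class $\mathfrak{F}$ of groups such that every quotient of a group in $\mathfrak{F}$ lies in $\mathfrak{F}$, and such that $G/(M\cap N)\in\mathfrak{F}$ whenever $M,N\trianglelefteq G$ and $G/M,\,G/N\in\mathfrak{F}$; it is saturated if $G/\Phi(G)\in\mathfrak{F}$ implies $G\in\mathfrak{F}$, where $\Phi(G)$ denotes the Frattini subgroup of $G$. A group is supersoluble if it has a finite series from $1$ to itself, consisting of normal subgroups of the whole group, with cyclic factors. The socle $\mathrm{Soc}(G)$ is the subgroup generated by all minimal normal subgroups of $G$, and $\tilde{\mathrm{F}}(G)$ is the subgroup of $G$ defined by $\Phi(G)\le\tilde{\mathrm{F}}(G)$ and $\tilde{\mathrm{F}}(G)/\Phi(G)=\mathrm{Soc}(G/\Phi(G))$. Theorem. Let $\mathfrak{F}$ be a saturated formation containing all supersoluble groups, and let $H$ be a normal subgroup of a group $G$ such that $G/H\in\mathfrak{F}$ and $\Phi(G)\cap H\le\Phi(H)$. If for every maximal subgroup $M$ of $G$ the index $|\tilde{\mathrm{F}}(H):\tilde{\mathrm{F}}(H)\cap M|$ is $1$ or a prime, then $G\in\mathfrak{F}$.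 -/

import Mathlib

universe u

/-- A class of finite groups (closure under isomorphism is part of `IsFormation`). -/
abbrev FiniteGroupClass : Type (u + 1) :=
  (G : Type u) → [Group G] → [Finite G] → Prop

/-- A formation: an isomorphism-closed class of finite groups that is closed under quotients and
contains `G / (M ∩ N)` whenever it contains `G / M` and `G / N`. -/
structure IsFormation (F : FiniteGroupClass.{u}) : Prop where
  of_mulEquiv : ∀ (G K : Type u) [Group G] [Finite G] [Group K] [Finite K],
    (G ≃* K) → F G → F K
  quotient : ∀ (G : Type u) [Group G] [Finite G] (N : Subgroup G) [N.Normal],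
    F G → F (G ⧸ N)
  subdirect : ∀ (G : Type u) [Group G] [Finite G] (M N : Subgroup G) [M.Normal] [N.Normal],
    F (G ⧸ M) → F (G ⧸ N) → F (G ⧸ (M ⊓ N))

/-- A saturated formation: `G` belongs to it as soon as `G / Φ(G)` does. -/
structure IsSaturatedFormation (F : FiniteGroupClass.{u}) : Prop extends IsFormation F where
  saturated : ∀ (G : Type u) [Group G] [Finite G], F (G ⧸ frattini G) → F G

/-- A group is supersoluble if it has a finite series `1 = N₀ ≤ N₁ ≤ ⋯ ≤ Nₙ = G` of normal
subgroups of `G` all of whose factors `Nᵢ₊₁ / Nᵢ` are cyclic. -/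
def IsSupersoluble (G : Type u) [Group G] : Prop :=
  ∃ (n : ℕ) (N : ℕ → Subgroup G) (_ : ∀ i, (N i).Normal),
    Monotone N ∧ N 0 = ⊥ ∧ N n = ⊤ ∧
      ∀ i < n, IsCyclic (N (i + 1) ⧸ (N i).subgroupOf (N (i + 1)))

/-- A minimal normal subgroup: minimal among the nontrivial normal subgroups. -/
def IsMinimalNormal {G : Type u} [Group G] (N : Subgroup G) : Prop :=
  Minimal (fun K : Subgroup G => K.Normal ∧ K ≠ ⊥) N

/-- The socle: the subgroup generated by all minimal normal subgroups. -/
def socle (G : Type u) [Group G] : Subgroup G :=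
  sSup {N : Subgroup G | IsMinimalNormal N}

/-- The subgroup `F̃(G)` with `Φ(G) ≤ F̃(G)` and `F̃(G) / Φ(G) = Soc(G / Φ(G))`. -/
def tildeFitting (G : Type u) [Group G] : Subgroup G :=
  (socle (G ⧸ frattini G)).comap (QuotientGroup.mk' (frattini G))

/-! Since Φ(H) ≤ Φ(G), saturation allows passing to G/Φ(H). There the image S of F̃(H) meets the
Frattini subgroup trivially, yet meets every nontrivial normal subgroup below the image of H. If the
𝔉-residual R were nontrivial, R ∩ S would contain a minimal normal subgroup N. Maximal subgroups
omitting N have prime index, and one exists because N avoids the Frattini subgroup. This forces N to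
be a p-group (`IsMinimalNormal.exists_isPGroup`), hence abelian, complemented by a maximal M and of
prime order. Then D = C(N) ∩ M is normal with supersoluble quotient
(`IsMinimalNormal.exists_isSupersoluble_quotient`), so N ≤ R ≤ D, which is absurd. -/

/-! ### Minimal normal subgroups and maximal subgroups of prime index -/

theorem exists_isMinimalNormal_le {G : Type u} [Group G] [Finite G] {K : Subgroup G}
    (hK : K.Normal) (hne : K ≠ ⊥) : ∃ N ≤ K, IsMinimalNormal N :=
  exists_minimal_le_of_wellFoundedLT (fun K : Subgroup G => K.Normal ∧ K ≠ ⊥) K ⟨hK, hne⟩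

namespace IsMinimalNormal

variable {G : Type u} [Group G] {N : Subgroup G}

theorem normal (hN : IsMinimalNormal N) : N.Normal := hN.prop.1

theorem ne_bot (hN : IsMinimalNormal N) : N ≠ ⊥ := hN.prop.2

theorem le_of_ne_bot (hN : IsMinimalNormal N) {K : Subgroup G} (hK : K.Normal) (hne : K ≠ ⊥)
    (hle : K ≤ N) : N ≤ K :=
  hN.le_of_le ⟨hK, hne⟩ hle

theorem inf_eq_bot (hN : IsMinimalNormal N) {K : Subgroup G} (hK : K.Normal) (hle : ¬ N ≤ K) :
    N ⊓ K = ⊥ := by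
  have := hN.normal
  by_contra h
  exact hle ((hN.le_of_ne_bot inferInstance h inf_le_left).trans inf_le_right)

end IsMinimalNormal

theorem Subgroup.relIndex_eq_index_of_sup_eq_top {G : Type u} [Group G] [Finite G]
    {M N : Subgroup G} [N.Normal] (h : M ⊔ N = ⊤) : M.relIndex N = M.index := by
  have h1 : N.relIndex M = N.index := by
    rw [← Subgroup.relIndex_sup_right, h, Subgroup.relIndex_top_right]
  have h2 := M.index_mul_card
  have h3 := N.index_mul_card
  have h4 := Subgroup.card_mul_index (N.subgroupOf M)
  have h5 := Subgroup.card_mul_index (M.subgroupOf N)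
  change _ * N.relIndex M = _ at h4
  change _ * M.relIndex N = _ at h5
  have h6 : Nat.card (N.subgroupOf M) = Nat.card (M.subgroupOf N) := by
    rw [← Subgroup.inf_subgroupOf_right,
      Nat.card_congr (Subgroup.subgroupOfEquivOfLe inf_le_right).toEquiv,
      ← Subgroup.inf_subgroupOf_right M N,
      Nat.card_congr (Subgroup.subgroupOfEquivOfLe inf_le_right).toEquiv, inf_comm]
  rw [h6, h1] at h4
  have hpos : 0 < Nat.card (M.subgroupOf N) * N.index :=
    Nat.mul_pos Nat.card_pos (Nat.pos_of_ne_zero Subgroup.index_ne_zero_of_finite)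
  apply Nat.eq_of_mul_eq_mul_left hpos
  calc _ = N.index * (Nat.card (M.subgroupOf N) * M.relIndex N) := by ring
    _ = M.index * (Nat.card (M.subgroupOf N) * N.index) := by rw [h5, h4, h2, h3]
    _ = _ := by ring

theorem IsCoatom.sup_eq_top_of_not_le {G : Type u} [Group G] {M N : Subgroup G} (hM : IsCoatom M)
    (hN : ¬ N ≤ M) : M ⊔ N = ⊤ :=
  hM.2 _ (left_lt_sup.2 hN)

/-- A minimal normal subgroup is a `p`-group as soon as all maximal subgroups that do not contain
it have prime index. -/
theorem IsMinimalNormal.exists_isPGroup {G : Type u} [Group G] [Finite G] {N : Subgroup G}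
    (hN : IsMinimalNormal N) (h : ∀ M : Subgroup G, IsCoatom M → ¬ N ≤ M → M.index.Prime) :
    ∃ p : ℕ, p.Prime ∧ IsPGroup p N := by
  have := hN.normal
  have hne : (Nat.card N).primeFactors.Nonempty := by
    rw [Nat.nonempty_primeFactors]
    exact N.one_lt_card_iff_ne_bot.2 hN.ne_bot
  -- Taking the largest prime divisor of |N| bounds by r the prime index of any maximal subgroup
  -- omitting N.
  set r := (Nat.card N).primeFactors.max' hne with hr
  have hrmem := Finset.max'_mem _ hne
  rw [← hr] at hrmem
  have hrp : r.Prime := Nat.prime_of_mem_primeFactors hrmem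
  have hrd : r ∣ Nat.card N := Nat.dvd_of_mem_primeFactors hrmem
  have : Fact r.Prime := ⟨hrp⟩
  refine ⟨r, hrp, ?_⟩
  obtain ⟨R⟩ : Nonempty (Sylow r N) := inferInstance
  set K := (R : Subgroup N).map N.subtype with hK
  have hKN : K ≤ N := Subgroup.map_subtype_le _
  have hKne : K ≠ ⊥ := by
    intro hb
    rw [hK, Subgroup.map_eq_bot_iff_of_injective _ N.subtype_injective] at hb
    exact R.ne_bot_of_dvd_card hrd hb
  by_cases hKn : K.Normal
  · have hNK := hN.le_of_ne_bot hKn hKne hKN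
    have hRtop : (R : Subgroup N) = ⊤ := by
      rw [eq_top_iff]
      intro x _
      obtain ⟨y, hy, hyx⟩ := hNK x.2
      rwa [← Subtype.ext hyx]
    have := R.isPGroup'
    rw [hRtop] at this
    exact this.of_equiv Subgroup.topEquiv
  · exfalso
    have hnt : Subgroup.normalizer (K : Set G) ≠ ⊤ :=
      fun e => hKn (Subgroup.normalizer_eq_top_iff.1 e)
    -- By the Frattini argument G = N_G(R)N, so a maximal M above N_G(R) omits N.
    obtain ⟨M, hM, hle⟩ := (eq_top_or_exists_le_coatom _).resolve_left hnt
    have hNM : ¬ N ≤ M := by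
      intro hNM
      have := R.normalizer_sup_eq_top
      exact hM.1 (eq_top_iff.2 (this ▸ sup_le hle hNM))
    have hq := h M hM hNM
    have hidx := Subgroup.relIndex_eq_index_of_sup_eq_top (hM.sup_eq_top_of_not_le hNM)
    have hKM : K ≤ M := Subgroup.le_normalizer.trans hle
    have hqr : M.index ≤ r :=
      Finset.le_max' _ _ (Nat.mem_primeFactors.2
        ⟨hq, hidx ▸ Subgroup.relIndex_dvd_card M N, Nat.card_pos.ne'⟩)
    have hne' : ¬ r ∣ M.index := by
      intro hd
      have h1 : M.relIndex N ∣ K.relIndex N := Subgroup.relIndex_dvd_of_le_left N hKM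
      have h2 : K.relIndex N = (R : Subgroup N).index := by
        rw [Subgroup.relIndex, hK, Subgroup.subgroupOf,
          Subgroup.comap_map_eq_self_of_injective N.subtype_injective]
      rw [h2, hidx] at h1
      exact R.not_dvd_index (hd.trans h1)
    have hcore : N ⊓ M.normalCore = ⊥ :=
      hN.inf_eq_bot inferInstance fun hle => hNM (hle.trans M.normalCore_le)
    -- N acts faithfully on G/M, so r divides |G : M|! and r ≤ |G : M|. Hence |G : M| = r, although
    -- M contains a Sylow r-subgroup of N.
    have hinj : Function.Injective ((MulAction.toPermHom G (G ⧸ M)).comp N.subtype) := by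
      rw [injective_iff_map_eq_one]
      intro x hx
      have : (x : G) ∈ M.normalCore := by
        rw [Subgroup.normalCore_eq_ker]
        exact hx
      have : (x : G) ∈ N ⊓ M.normalCore := ⟨x.2, this⟩
      rw [hcore, Subgroup.mem_bot] at this
      exact Subtype.ext this
    have hd := Subgroup.card_dvd_of_injective _ hinj
    rw [Nat.card_perm] at hd
    have hle : r ≤ M.index := hrp.dvd_factorial.1 (hrd.trans hd)
    exact hne' (le_antisymm hle hqr ▸ dvd_rfl)

/-- The centre of a nontrivial p-group is nontrivial and characteristic, so minimality makes it all
of N. -/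
theorem IsMinimalNormal.le_centralizer {G : Type u} [Group G] [Finite G] {N : Subgroup G}
    (hN : IsMinimalNormal N) {p : ℕ} (hp : p.Prime) (h : IsPGroup p N) :
    N ≤ Subgroup.centralizer N := by
  have := hN.normal
  have : Fact p.Prime := ⟨hp⟩
  have : Nontrivial N := (Subgroup.nontrivial_iff_ne_bot N).2 hN.ne_bot
  have hc := h.center_nontrivial
  have hne : (Subgroup.center N).map N.subtype ≠ ⊥ := by
    intro hb
    rw [Subgroup.map_eq_bot_iff_of_injective _ N.subtype_injective] at hb
    exact (Subgroup.nontrivial_iff_ne_bot _).1 hc hb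
  have hle := hN.le_of_ne_bot inferInstance hne (Subgroup.map_subtype_le _)
  intro x hx
  obtain ⟨y, hy, rfl⟩ := hle hx
  rw [Subgroup.mem_centralizer_iff]
  intro z hz
  exact congrArg Subtype.val (Subgroup.mem_center_iff.1 hy ⟨z, hz⟩)

/-! ### Supersoluble quotients -/

theorem IsSupersoluble.of_isCyclic_ker {Q : Type u} {A : Type*} [Group Q] [Group A] [IsCyclic A]
    (φ : Q →* A) (h : IsCyclic φ.ker) : IsSupersoluble Q := by
  refine ⟨2, fun i => match i with | 0 => ⊥ | 1 => φ.ker | _ + 2 => ⊤, ?_, ?_, rfl, rfl, ?_⟩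
  · rintro (_ | _ | i) <;> dsimp only <;> infer_instance
  · refine monotone_nat_of_le_succ ?_
    rintro (_ | _ | i)
    exacts [bot_le, le_top, le_rfl]
  · intro i hi
    interval_cases i
    · exact isCyclic_of_surjective (QuotientGroup.mk' _) (QuotientGroup.mk'_surjective _)
    · refine isCyclic_of_injective
        (QuotientGroup.lift _ (φ.comp (Subgroup.subtype ⊤)) fun x hx => hx) ?_
      rw [injective_iff_map_eq_one]
      rintro ⟨x⟩ hx
      exact (QuotientGroup.eq_one_iff x).2 hx

theorem MulAut.ker_conjNormal {G : Type u} [Group G] (N : Subgroup G) [N.Normal] :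
    (MulAut.conjNormal : G →* MulAut N).ker = Subgroup.centralizer N := by
  ext g
  rw [MonoidHom.mem_ker, Subgroup.mem_centralizer_iff]
  constructor
  · intro h x hx
    have := congrArg Subtype.val (DFunLike.congr_fun h ⟨x, hx⟩)
    rw [MulAut.conjNormal_apply] at this
    exact (mul_inv_eq_iff_eq_mul.1 this).symm
  · intro h
    ext x
    rw [MulAut.conjNormal_apply]
    exact mul_inv_eq_iff_eq_mul.2 (h x x.2).symm

theorem isCyclic_mulAut_of_prime_card {N : Type u} [Group N] {p : ℕ} (hp : p.Prime)
    (h : Nat.card N = p) : IsCyclic (MulAut N) := by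
  have : Fact p.Prime := ⟨hp⟩
  have : IsCyclic N := isCyclic_of_prime_card h
  have e := IsCyclic.mulAutMulEquiv N
  rw [h] at e
  exact isCyclic_of_injective e.toMonoidHom e.injective

/-- For D = C(N) ∩ M, the section C(N)/D has prime order |G : M|, and G/C(N) embeds in the cyclic
group Aut N. -/
theorem IsMinimalNormal.exists_isSupersoluble_quotient {G : Type u} [Group G] [Finite G]
    {N : Subgroup G} (hN : IsMinimalNormal N)
    (h : ∀ M : Subgroup G, IsCoatom M → ¬ N ≤ M → M.index.Prime)
    (hΦ : ∃ M : Subgroup G, IsCoatom M ∧ ¬ N ≤ M) :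
    ∃ (D : Subgroup G) (_ : D.Normal), ¬ N ≤ D ∧ IsSupersoluble (G ⧸ D) := by
  have := hN.normal
  obtain ⟨M, hM, hNM⟩ := hΦ
  obtain ⟨p, hp, hpN⟩ := hN.exists_isPGroup h
  have hNC := hN.le_centralizer hp hpN
  have hsup := hM.sup_eq_top_of_not_le hNM
  have hq := h M hM hNM
  set C := Subgroup.centralizer (N : Set G) with hC
  have hCn : C.Normal := by rw [hC, ← MulAut.ker_conjNormal]; infer_instance
  -- M normalizes both C and M, while N centralizes C; together they generate G.
  have hDn : (C ⊓ M).Normal := by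
    rw [← Subgroup.normalizer_eq_top_iff, eq_top_iff, ← hsup]
    refine sup_le (fun g hg => ?_) (fun g hg => ?_)
    · rw [Subgroup.mem_normalizer_iff]
      intro x
      rw [Subgroup.mem_inf, Subgroup.mem_inf, hCn.mem_comm_iff, ← mul_assoc, inv_mul_cancel,
        one_mul, M.mul_mem_cancel_right (M.inv_mem hg), M.mul_mem_cancel_left hg]
    · rw [Subgroup.mem_normalizer_iff]
      intro x
      have hcomm : ∀ y ∈ C, g * y * g⁻¹ = y := fun y hy =>
        mul_inv_eq_iff_eq_mul.2 (Subgroup.mem_centralizer_iff.1 hy g hg)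
      constructor
      · intro hx
        rwa [hcomm x hx.1]
      · intro hx
        have hxC : x ∈ C := by
          have := hCn.conj_mem _ hx.1 g⁻¹
          simpa [mul_assoc] using this
        rwa [hcomm x hxC] at hx
  have hND : ¬ N ≤ C ⊓ M := fun hle => hNM (hle.trans inf_le_right)
  refine ⟨C ⊓ M, hDn, hND, ?_⟩
  have hbot := hN.inf_eq_bot hDn hND
  have hcard : Nat.card N = M.index := by
    rw [← Subgroup.relIndex_eq_index_of_sup_eq_top hsup, ← Subgroup.relIndex_bot_left,
      ← hbot, ← inf_assoc, inf_eq_left.2 hNC, Subgroup.inf_relIndex_left]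
  have hcyc : IsCyclic (MulAut N) := isCyclic_mulAut_of_prime_card hq hcard
  have hker : C ⊓ M ≤ (MulAut.conjNormal : G →* MulAut N).ker := by
    rw [MulAut.ker_conjNormal]; exact inf_le_left
  refine IsSupersoluble.of_isCyclic_ker (QuotientGroup.lift (C ⊓ M) MulAut.conjNormal hker) ?_
  have : Fact M.index.Prime := ⟨hq⟩
  refine isCyclic_of_prime_card (p := M.index) ?_
  have hsupC : M ⊔ C = ⊤ := eq_top_iff.2 (hsup ▸ sup_le_sup_left hNC M)
  rw [QuotientGroup.ker_lift, MulAut.ker_conjNormal, ← Subgroup.relIndex_ker,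
    QuotientGroup.ker_mk', Subgroup.inf_relIndex_left,
    Subgroup.relIndex_eq_index_of_sup_eq_top hsupC]

/-! ### The residual of a formation -/

/-- The `F`-residual: the least normal subgroup with quotient in `F`. -/
theorem IsFormation.exists_residual {F : FiniteGroupClass.{u}} (hF : IsFormation F)
    {G : Type u} [Group G] [Finite G] {H : Subgroup G} [H.Normal] (hH : F (G ⧸ H)) :
    ∃ (R : Subgroup G) (_ : R.Normal), F (G ⧸ R) ∧
      ∀ (D : Subgroup G) [D.Normal], F (G ⧸ D) → R ≤ D := by
  obtain ⟨R, -, hR⟩ := exists_minimal_le_of_wellFoundedLT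
    (fun D : Subgroup G => ∃ _ : D.Normal, F (G ⧸ D)) H ⟨inferInstance, hH⟩
  obtain ⟨hRn, hRF⟩ := hR.prop
  refine ⟨R, hRn, hRF, fun D _ hD => ?_⟩
  exact (hR.le_of_le ⟨inferInstance, hF.subdirect G R D hRF hD⟩ inf_le_left).trans inf_le_right

/-- If `G / H ∈ F`, a normal subgroup `S` avoids the Frattini subgroup and meets all nontrivial
normal subgroups below `H`, and all maximal subgroups have index `1` or a prime in `S`,
then `G ∈ F`. -/
theorem IsFormation.mem_of_relIndex_prime {F : FiniteGroupClass.{u}} (hF : IsFormation F)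
    (hU : ∀ (K : Type u) [Group K] [Finite K], IsSupersoluble K → F K)
    {G : Type u} [Group G] [Finite G] {H : Subgroup G} [H.Normal] (hH : F (G ⧸ H))
    {S : Subgroup G} [S.Normal] (hΦ : S ⊓ frattini G = ⊥)
    (hS : ∀ K : Subgroup G, K.Normal → K ≤ H → K ≠ ⊥ → K ⊓ S ≠ ⊥)
    (hM : ∀ M : Subgroup G, IsCoatom M → M.relIndex S = 1 ∨ (M.relIndex S).Prime) : F G := by
  obtain ⟨R, hRn, hRF, hR⟩ := hF.exists_residual hH
  have hbot : R = ⊥ := by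
    by_contra hne
    obtain ⟨N, hNle, hN⟩ := exists_isMinimalNormal_le (K := R ⊓ S) inferInstance
      (hS R hRn (hR H hH) hne)
    have hNS := hNle.trans inf_le_right
    obtain ⟨D, hDn, hND, hD⟩ := hN.exists_isSupersoluble_quotient
      (fun M hMc hNM => by
        -- M omits S as well, so G = MS and |S : S ∩ M| = |G : M|.
        have hSM : ¬ S ≤ M := fun hSM => hNM (hNS.trans hSM)
        have := hM M hMc
        rw [Subgroup.relIndex_eq_one,
          Subgroup.relIndex_eq_index_of_sup_eq_top (hMc.sup_eq_top_of_not_le hSM)] at this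
        exact this.resolve_left hSM)
      (by
        by_contra! hall
        refine hN.ne_bot (eq_bot_iff.2 (hΦ ▸ le_inf hNS ?_))
        exact le_iInf₂ hall)
    exact hND ((hNle.trans inf_le_left).trans (hR D (hU _ hD)))
  subst hbot
  exact hF.of_mulEquiv _ _ QuotientGroup.quotientBot hRF

/-! ### Frattini subgroups, F̃ and the reduction modulo Φ(H) -/

theorem map_frattini_le_frattini {G : Type u} [Group G] [Finite G] (H : Subgroup G) [H.Normal] :
    (frattini H).map H.subtype ≤ frattini G := by
  refine le_iInf₂ fun M hM => ?_
  by_contra hle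
  have hsup := hM.sup_eq_top_of_not_le hle
  -- Dedekind's law: G = MΦ(H) gives H = (M ∩ H)Φ(H).
  have htop : M.subgroupOf H ⊔ frattini H = ⊤ := by
    rw [eq_top_iff]
    intro x _
    have hx : (x : G) ∈ M ⊔ (frattini H).map H.subtype := hsup ▸ Subgroup.mem_top _
    obtain ⟨m, hm, _, ⟨y, hy, rfl⟩, hmy⟩ := Subgroup.mem_sup_of_normal_right.1 hx
    have hmx : m = ((x * y⁻¹ : H) : G) := eq_mul_inv_of_mul_eq hmy
    have hmem : x * y⁻¹ ∈ M.subgroupOf H := by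
      rwa [Subgroup.mem_subgroupOf, ← hmx]
    rw [← inv_mul_cancel_right x y]
    exact Subgroup.mul_mem_sup hmem hy
  have hHM : H ≤ M := Subgroup.subgroupOf_eq_top.1 (frattini_nongenerating htop)
  exact hle ((Subgroup.map_subtype_le _).trans hHM)

theorem IsMinimalNormal.map_mulEquiv {G : Type u} [Group G] {N : Subgroup G}
    (hN : IsMinimalNormal N) (φ : G ≃* G) : IsMinimalNormal (N.map φ.toMonoidHom) := by
  refine ⟨⟨hN.normal.map _ φ.surjective, ?_⟩, fun K hK hle => ?_⟩
  · rw [Ne, Subgroup.map_eq_bot_iff_of_injective _ φ.injective]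
    exact hN.ne_bot
  · rw [Subgroup.map_le_iff_le_comap]
    refine hN.le_of_ne_bot (hK.1.comap _) (fun h => hK.2 ?_) ?_
    · rw [← Subgroup.map_comap_eq_self_of_surjective (f := φ.toMonoidHom) φ.surjective K, h,
        Subgroup.map_bot]
    · rw [← Subgroup.comap_map_eq_self_of_injective (f := φ.toMonoidHom) φ.injective N]
      exact Subgroup.comap_mono hle

instance socle_characteristic (G : Type u) [Group G] : (socle G).Characteristic := by
  rw [Subgroup.characteristic_iff_le_comap]
  intro φ
  refine sSup_le fun N hN => ?_
  rw [← Subgroup.map_le_iff_le_comap]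
  exact le_sSup (α := Subgroup G) (hN.map_mulEquiv φ)

instance tildeFitting_characteristic (G : Type u) [Group G] : (tildeFitting G).Characteristic := by
  rw [Subgroup.characteristic_iff_le_comap]
  intro φ x hx
  have h := Subgroup.characteristic_iff_le_comap.1 (socle_characteristic (G ⧸ frattini G))
    (QuotientGroup.congr (frattini G) (frattini G) φ
      (Subgroup.characteristic_iff_map_eq.1 inferInstance φ))
  exact h hx

theorem exists_mem_tildeFitting_notMem_frattini {G : Type u} [Group G] [Finite G]
    {K : Subgroup G} (hK : K.Normal) (h : ¬ K ≤ frattini G) :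
    ∃ x ∈ K, x ∈ tildeFitting G ∧ x ∉ frattini G := by
  have hs := QuotientGroup.mk'_surjective (frattini G)
  have hn : (K.map (QuotientGroup.mk' (frattini G))).Normal := hK.map _ hs
  have hne : K.map (QuotientGroup.mk' (frattini G)) ≠ ⊥ := by
    rwa [Ne, Subgroup.map_eq_bot_iff, QuotientGroup.ker_mk']
  obtain ⟨N, hNK, hN⟩ := exists_isMinimalNormal_le hn hne
  obtain ⟨z, hz, hz1⟩ := N.bot_or_exists_ne_one.resolve_left hN.ne_bot
  obtain ⟨x, hx, rfl⟩ := hNK hz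
  refine ⟨x, hx, ?_, fun hx' => hz1 ((QuotientGroup.eq_one_iff x).2 hx')⟩
  exact (le_sSup (α := Subgroup (G ⧸ frattini G)) hN : N ≤ socle _) hz

theorem IsCoatom.map_of_surjective_of_ker_le {G Q : Type*} [Group G] [Group Q] {f : G →* Q}
    (hf : Function.Surjective f) {M : Subgroup G} (hM : IsCoatom M) (hker : f.ker ≤ M) :
    IsCoatom (M.map f) := by
  have hcomap : (M.map f).comap f = M := Subgroup.comap_map_eq_self hker
  refine ⟨fun h => hM.1 ?_, fun K hK => ?_⟩
  · rw [← hcomap, h, Subgroup.comap_top]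
  · have hlt : M < K.comap f := by
      rw [← hcomap]
      exact (Subgroup.comap_lt_comap_of_surjective hf).2 hK
    rw [← Subgroup.map_comap_eq_self_of_surjective hf K, hM.2 _ hlt,
      Subgroup.map_top_of_surjective f hf]

theorem comap_mk'_frattini_le {G : Type u} [Group G] {N : Subgroup G} [N.Normal]
    (hN : N ≤ frattini G) :
    (frattini (G ⧸ N)).comap (QuotientGroup.mk' N) ≤ frattini G := by
  refine le_iInf₂ fun M hM => ?_
  have hker : (QuotientGroup.mk' N).ker ≤ M := by
    rw [QuotientGroup.ker_mk']
    exact hN.trans (frattini_le_coatom hM)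
  rw [← Subgroup.comap_map_eq_self hker]
  exact Subgroup.comap_mono (frattini_le_coatom
    (hM.map_of_surjective_of_ker_le (QuotientGroup.mk'_surjective N) hker))

theorem IsSaturatedFormation.mem_of_quotient_mem {F : FiniteGroupClass.{u}}
    (hF : IsSaturatedFormation F) {G : Type u} [Group G] [Finite G] {N : Subgroup G} [N.Normal]
    (hN : N ≤ frattini G) (h : F (G ⧸ N)) : F G :=
  hF.saturated G (hF.of_mulEquiv _ _ (QuotientGroup.quotientQuotientEquivQuotient N _ hN)
    (hF.quotient _ ((frattini G).map (QuotientGroup.mk' N)) h))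

theorem theorem2 (F : FiniteGroupClass.{u}) (hF : IsSaturatedFormation F)
    (hU : ∀ (K : Type u) [Group K] [Finite K], IsSupersoluble K → F K)
    (G : Type u) [Group G] [Finite G] (H : Subgroup G) [H.Normal]
    (hGH : F (G ⧸ H))
    (hΦ : frattini G ⊓ H ≤ (frattini H).map H.subtype)
    (hM : ∀ M : Subgroup G, IsCoatom M →
      ((tildeFitting H).map H.subtype ⊓ M).relIndex ((tildeFitting H).map H.subtype) = 1 ∨
      (((tildeFitting H).map H.subtype ⊓ M).relIndex
        ((tildeFitting H).map H.subtype)).Prime) :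
    F G := by
  have hle : (frattini H).map H.subtype ≤ H := Subgroup.map_subtype_le _
  have hleΦ := map_frattini_le_frattini H
  refine hF.mem_of_quotient_mem hleΦ ?_
  set π := QuotientGroup.mk' ((frattini H).map H.subtype) with hπ
  have hsurj : Function.Surjective π := QuotientGroup.mk'_surjective _
  have hSn : (((tildeFitting H).map H.subtype).map π).Normal :=
    Subgroup.Normal.map inferInstance π hsurj
  have hHn : (H.map π).Normal := Subgroup.Normal.map inferInstance π hsurj
  refine hF.mem_of_relIndex_prime hU (H := H.map π) (S := ((tildeFitting H).map H.subtype).map π)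
    (hF.of_mulEquiv _ _ (QuotientGroup.quotientQuotientEquivQuotient _ H hle).symm hGH)
    ?_ ?_ ?_
  · rw [eq_bot_iff]
    -- The Frattini subgroup of G/Φ(H) pulls back into Φ(G), and Φ(G) ∩ H ≤ Φ(H) is killed by π.
    rintro _ ⟨⟨t, ht, rfl⟩, htΦ⟩
    exact (QuotientGroup.eq_one_iff t).2
      (hΦ ⟨comap_mk'_frattini_le hleΦ htΦ, Subgroup.map_subtype_le _ ht⟩)
  · intro K hK hKH hne hbot
    have hKn : ((K.comap π).subgroupOf H).Normal := inferInstance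
    -- As K ≠ 1 lies in the image of H, its preimage in H is not inside Φ(H), so it meets F̃(H)
    -- outside Φ(H).
    obtain ⟨x, hxK, hxT, hxΦ⟩ := exists_mem_tildeFitting_notMem_frattini hKn (by
      intro hKΦ
      refine hne (eq_bot_iff.2 fun z hz => ?_)
      obtain ⟨h, hh, rfl⟩ := hKH hz
      exact (QuotientGroup.eq_one_iff h).2 ⟨⟨h, hh⟩, hKΦ hz, rfl⟩)
    have hx1 : π x ∈ K ⊓ ((tildeFitting H).map H.subtype).map π :=
      ⟨hxK, x, ⟨x, hxT, rfl⟩, rfl⟩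
    rw [hbot, Subgroup.mem_bot] at hx1
    obtain ⟨y, hy, hyx⟩ := (QuotientGroup.eq_one_iff (x : G)).1 hx1
    exact hxΦ (Subtype.ext hyx ▸ hy)
  · intro M hMc
    have := hM _ (Subgroup.isCoatom_comap_of_surjective hsurj hMc)
    rwa [Subgroup.inf_relIndex_left, Subgroup.relIndex_comap] at this
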